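/- Let $\mu$ be Lebesgue measure on $\mathbb R^2$, $\overline\mu$ the Lebesgue probability measure on $\mathbb R^2/\mathbb Z^2$, and let $T:\mathbb R^2\to\mathbb R^2$, $T(x)=x+v$, be a translation, with induced map $\overline T$ on $\mathbb R^2/\mathbb Z^2$. Two measure-preserving systems are called conjugate in measure if they are isomorphic modulo null sets. An exchange of $m\ge 1$ pieces adapted to $T$ consists of Lebesgue measurable sets $D_1,\dots,D_m\subset\mathbb R^2$ (not necessarily bounded) with $\mu(D_i\cap D_j)=0$ for $i\ne j$, and a map $R$ on $D=\bigcup_i D_i$, such that: (1) the system $(D,R,\mu|_D)$ is measure-preserving and conjugate in measure to $(\mathbb R^2/\mathbb Z^2,\overline T,\overline\mu)$; (2) the set of $x\in D$ for which there is $y\in D$, $y\neq x$, with $x-y\in\mathbb Z^2$ is $\mu$-null; (3) there are $n_1,\dots,n_m\in\mathbb Z^2$ such that for every $x\in D$, $R(x)=T(x)-n_i$ if $x\in D_i$ (if $x$ lies in several pieces, for one of them). For $\mu$-almost every $x\in D$, namely whenever each $R^k(x)$, $k\ge 0$, lies in exactly one piece, the coding $C(x)\in\{1,\dots,m\}^{\mathbb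 N}$ is the sequence whose $k$-th term is the $i$ with $R^k(x)\in D_i$. Let $p_R(n)$ be the number of words of length $n$ that occur as a block of consecutive letters in some coding $C(x)$. The exchange is called conjugate to $T$ if it is adapted to $T$ and the shift on $\{1,\dots,m\}^{\mathbb N}$ with the image measure of $\mu|_D$ under $C$ is conjugate in measure to $(\mathbb R^2/\mathbb Z^2,\overline T,\overline\mu)$. Theorem. If $\overline T$ is ergodic for $\overline\mu$, then there exists an exchange of pieces conjugate to $T$ (with some finite number $m$ of pieces), so that the complexity function $$p^T(n)=\inf\{p_R(n) : R \text{ is an exchange of pieces conjugate to } T\}$$ is well defined, and $p^T(n)\ge 2n+1$ for every integer $n\ge 0$. -/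

import Mathlib

open MeasureTheory

noncomputable section

/-- The plane `ℝ²`; its `volume` is the Lebesgue measure. -/
abbrev Plane : Type := Fin 2 → ℝ

/-- The torus `ℝ²/ℤ²`; its `volume` is the Lebesgue (Haar) probability measure. -/
abbrev Torus : Type := UnitAddTorus (Fin 2)

/-- The canonical projection `ℝ² → ℝ²/ℤ²`. -/
def torusProj (x : Plane) : Torus := fun i => (x i : UnitAddCircle)

/-- The representative in `[0,1)²` of a point of the torus. -/
def torusRep (p : Torus) : Plane := fun i => (AddCircle.equivIco 1 0 (p i) : ℝ)

/-- The map of the torus induced by a map `T` of the plane that is (almost surely)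
`ℤ²`-periodic modulo `ℤ²`. -/
def inducedMap (T : Plane → Plane) (p : Torus) : Torus := torusProj (T (torusRep p))

theorem torusProj_torusRep (p : Torus) : torusProj (torusRep p) = p := by
  funext i
  exact (AddCircle.equivIco (1 : ℝ) 0).symm_apply_apply (p i)

/-- The map induced by a translation is the corresponding rotation of the torus. -/
theorem inducedMap_of_translation {T : Plane → Plane} {v : Plane} (hT : ∀ x, T x = x + v)
    (p : Torus) : inducedMap T p = p + torusProj v := by
  have h : inducedMap T p = torusProj (torusRep p) + torusProj v := by
    funext i
    simp [inducedMap, hT, torusProj]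
  rw [h, torusProj_torusRep]

/-- `f` carries `μ` to `ν`. Almost everywhere measurability is measurability with respect to the
completed measure, e.g. Lebesgue measurability for maps of the plane. -/
def Transports {X Y : Type*} [MeasurableSpace X] [MeasurableSpace Y]
    (f : X → Y) (μ : Measure X) (ν : Measure Y) : Prop :=
  AEMeasurable f μ ∧ μ.map f = ν

/-- The measured dynamical systems `(X, T, μ)` and `(Y, S, ν)` are conjugate in measure
(isomorphic): both maps preserve their measure, and there is an isomorphism modulo null sets
of the measure spaces that intertwines the two maps almost everywhere. -/
def ConjugateInMeasure {X Y : Type*} [MeasurableSpace X] [MeasurableSpace Y]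
    (T : X → X) (μ : Measure X) (S : Y → Y) (ν : Measure Y) : Prop :=
  Transports T μ μ ∧ Transports S ν ν ∧
    ∃ (f : X → Y) (g : Y → X), Transports f μ ν ∧ Transports g ν μ ∧
      (∀ᵐ x ∂μ, g (f x) = x) ∧ (∀ᵐ y ∂ν, f (g y) = y) ∧
      ∀ᵐ x ∂μ, f (T x) = S (f x)

/-- The data of an exchange of `m` pieces of the plane: the pieces and the map. Only the values
of `map` on the union of the pieces matter. -/
structure PieceExchange where
  m : ℕ
  m_pos : 0 < m
  piece : Fin m → Set Plane
  map : Plane → Plane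

/-- `u` is a (finite) factor of the infinite word `v`. -/
def IsFactor {α : Type*} (u : List α) (v : ℕ → α) : Prop :=
  ∃ k : ℕ, ∀ (j : ℕ) (h : j < u.length), u[j] = v (k + j)

/-- The shift on infinite words. -/
def shiftMap {α : Type*} (u : ℕ → α) : ℕ → α := fun n => u (n + 1)

namespace PieceExchange

/-- The domain, i.e. the union of the pieces. -/
def domain (R : PieceExchange) : Set Plane := ⋃ i, R.piece i

/-- Lebesgue measure on the domain. -/
def measure (R : PieceExchange) : Measure Plane := volume.restrict R.domain

/-- `R` is adapted to the map `T` of the plane. A point of the (null) intersection of several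
pieces may be moved by the rule of any one of them. -/
structure IsAdapted (R : PieceExchange) (T : Plane → Plane) : Prop where
  conjugate : ConjugateInMeasure R.map R.measure (inducedMap T) (volume : Measure Torus)
  measurable_piece : ∀ i, NullMeasurableSet (R.piece i) volume
  disjoint : ∀ i j, i ≠ j → volume (R.piece i ∩ R.piece j) = 0
  injective_mod : volume {x : Plane | x ∈ R.domain ∧
    ∃ y ∈ R.domain, y ≠ x ∧ ∃ k : Fin 2 → ℤ, x - y = fun c => (k c : ℝ)} = 0
  map_eq : ∃ N : Fin R.m → Fin 2 → ℤ, ∀ x ∈ R.domain, ∃ i, x ∈ R.piece i ∧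
    R.map x = T x - fun c => (N i c : ℝ)

/-- The points that have a well defined coding: at each time the orbit lies in exactly
one piece. For an adapted exchange, almost every point of the domain is such. -/
def codedPoints (R : PieceExchange) : Set Plane :=
  {x | ∀ n : ℕ, ∃! i, R.map^[n] x ∈ R.piece i}

open Classical in
/-- The coding map: the `n`-th term of `coding x` is `i` if `R^n x` is in the `i`-th piece
(arbitrary values outside `codedPoints`). -/
def coding (R : PieceExchange) (x : Plane) (n : ℕ) : Fin R.m :=
  if h : ∃ i, R.map^[n] x ∈ R.piece i then h.choose else ⟨0, R.m_pos⟩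

theorem coding_eq_iff (R : PieceExchange) {x : Plane} (hx : x ∈ R.codedPoints) (n : ℕ)
    (i : Fin R.m) : R.coding x n = i ↔ R.map^[n] x ∈ R.piece i := by
  have h := (hx n).exists
  have hc : R.map^[n] x ∈ R.piece (R.coding x n) := by
    rw [coding, dif_pos h]
    exact h.choose_spec
  exact ⟨fun e => e ▸ hc, fun hi => (hx n).unique hc hi⟩

/-- The set of codings of points of the domain. -/
def symbolicSet (R : PieceExchange) : Set (ℕ → Fin R.m) := R.coding '' R.codedPoints

/-- The measure on infinite words that is the image under the coding of Lebesgue measure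
on the domain (it is carried by `symbolicSet` when the exchange is adapted). -/
def symbolicMeasure (R : PieceExchange) : Measure (ℕ → Fin R.m) := R.measure.map R.coding

/-- The language: the finite factors of the codings. -/
def language (R : PieceExchange) : Set (List (Fin R.m)) :=
  {u | ∃ v ∈ R.symbolicSet, IsFactor u v}

/-- The complexity function: the number of words of length `n` of the language. -/
def complexity (R : PieceExchange) (n : ℕ) : ℕ :=
  {u : List (Fin R.m) | u ∈ R.language ∧ u.length = n}.ncard

/-- `R` is conjugate to `T`: it is adapted to `T` and its symbolic system is conjugate in
measure to the system induced by `T` on the torus. -/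
def IsConjugateTo (R : PieceExchange) (T : Plane → Plane) : Prop :=
  R.IsAdapted T ∧
    ConjugateInMeasure shiftMap R.symbolicMeasure (inducedMap T) (volume : Measure Torus)

end PieceExchange

/-- The complexity function of `T`. It is well defined if some exchange of pieces is
conjugate to `T`. -/
def mapComplexity (T : Plane → Plane) (n : ℕ) : ℕ :=
  sInf {k : ℕ | ∃ R : PieceExchange, R.IsConjugateTo T ∧ k = R.complexity n}

end

noncomputable section

open Filter

/-! Lower bound: the words of length `n` and `n + 1` read with positive measure are the vertices and
edges of a finite graph. A conjugacy gives a plane-valued `g` on the torus that moves at each step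
by `v` minus an integer vector `N` of the label. On the edges, the constant function and the two
coordinates of `N` are independent modulo coboundaries of vertex functions: a relation among them
makes a real function with constant increment, which recurrence forces to be zero (`drift_eq_zero`),
against the rational independence of `1, v 0, v 1`. By ergodicity the kernel of the coboundary is
the constants, so edges exceed vertices by at least 3 - 1 = 2 (`ncard_positiveWords_succ`).

Existence: cut `[0,1)²` according to the carries in `x + v`. Points with the same coding keep a
constant difference inside the box, which density of orbits allows only if they are equal
(`torusCoding_injective`). -/

/-- The word of length `n` read along the orbit of `y` under `S` by the labelling `ℓ`. -/
def orbitWord {Ω A : Type*} (S : Ω → Ω) (ℓ : Ω → A) (n : ℕ) (y : Ω) : Fin n → A :=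
  fun j => ℓ (S^[j] y)

/-- The words of length `n` that are read with positive measure. -/
def positiveWords {Ω A : Type*} [MeasurableSpace Ω] (μ : Measure Ω) (S : Ω → Ω) (ℓ : Ω → A)
    (n : ℕ) : Set (Fin n → A) :=
  {u | ∃ᵐ y ∂μ, orbitWord S ℓ n y = u}

/-! ### Words read with positive measure -/

section Words

variable {Ω A : Type*} [MeasurableSpace Ω] {μ : Measure Ω} {S : Ω → Ω} {ℓ : Ω → A}

theorem init_mem_positiveWords {n : ℕ} {w : Fin (n + 1) → A}
    (hw : w ∈ positiveWords μ S ℓ (n + 1)) :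
    (fun j : Fin n => w j.castSucc) ∈ positiveWords μ S ℓ n :=
  Frequently.mono hw fun y hy => by rw [← hy]; rfl

theorem tail_mem_positiveWords (hS : Measure.QuasiMeasurePreserving S μ μ) {n : ℕ}
    {w : Fin (n + 1) → A} (hw : w ∈ positiveWords μ S ℓ (n + 1)) :
    (fun j : Fin n => w j.succ) ∈ positiveWords μ S ℓ n := by
  refine hS.tendsto_ae.frequently ?_
  exact Frequently.mono hw fun y hy => by rw [← hy]; rfl

theorem ae_orbitWord_mem_positiveWords [Finite A] (n : ℕ) :
    ∀ᵐ y ∂μ, orbitWord S ℓ n y ∈ positiveWords μ S ℓ n := by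
  have h : ∀ᵐ y ∂μ, ∀ u : Fin n → A, u ∉ positiveWords μ S ℓ n → orbitWord S ℓ n y ≠ u := by
    rw [ae_all_iff]
    intro u
    by_cases hu : u ∈ positiveWords μ S ℓ n
    · simp [hu]
    · filter_upwards [not_frequently.mp hu] with y hy _ using hy
  filter_upwards [h] with y hy
  by_contra hc
  exact hy _ hc rfl

theorem aemeasurable_orbitWord [MeasurableSpace A] (hS : Measure.QuasiMeasurePreserving S μ μ)
    (hℓ : AEMeasurable ℓ μ) (n : ℕ) : AEMeasurable (orbitWord S ℓ n) μ :=
  aemeasurable_pi_lambda _ fun j => hℓ.comp_quasiMeasurePreserving (hS.iterate j)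

end Words

/-! ### Growth of the number of words -/

/-- A function that is, up to a bounded error, increased by a constant `c` at each step of a
finite measure-preserving system has `c = 0`. -/
theorem drift_eq_zero {Ω : Type*} [MeasurableSpace Ω] {μ : Measure Ω} [IsFiniteMeasure μ]
    [NeZero μ] {S : Ω → Ω} (hS : MeasurePreserving S μ μ) {G B : Ω → ℝ} (hG : AEMeasurable G μ)
    {H c : ℝ} (hB : ∀ y, |B y| ≤ H)
    (hc : ∀ᵐ y ∂μ, G (S y) + B (S y) = G y + B y + c) : c = 0 := by
  have hall : ∀ᵐ y ∂μ, ∀ k : ℕ, G (S^[k + 1] y) + B (S^[k + 1] y)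
      = G (S^[k] y) + B (S^[k] y) + c := by
    rw [ae_all_iff]
    intro k
    filter_upwards [(hS.iterate k).quasiMeasurePreserving.ae hc] with y hy
    rwa [Function.iterate_succ_apply']
  -- Poincaré recurrence replaces integration: `G` need not be integrable, as the pieces may be
  -- unbounded.
  have hrec : ∀ᵐ y ∂μ, ∀ M : ℕ, |G y| ≤ M → ∃ᶠ k in atTop, |G (S^[k] y)| ≤ M := by
    rw [ae_all_iff]
    intro M
    have hs : NullMeasurableSet {y | |G y| ≤ (M : ℝ)} μ :=
      nullMeasurableSet_le hG.abs aemeasurable_const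
    exact hS.conservative.ae_mem_imp_frequently_image_mem hs
  obtain ⟨y, hy, hr⟩ := (hall.and hrec).exists
  obtain ⟨M, hM⟩ := exists_nat_ge |G y|
  have hlin : ∀ k : ℕ, G (S^[k] y) + B (S^[k] y) = G y + B y + k * c := by
    intro k
    induction k with
    | zero => simp
    | succ k ih => rw [hy k, ih]; push_cast; ring
  by_contra hne
  have hpos : 0 < |c| := abs_pos.mpr hne
  obtain ⟨K, hK⟩ := exists_nat_gt ((2 * M + 2 * H) / |c|)
  obtain ⟨k, hk, hk'⟩ := frequently_atTop.mp (hr M hM) K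
  have hkK : (K : ℝ) ≤ k := by exact_mod_cast hk
  have h1 : (2 * M + 2 * H) < k * |c| := by
    rw [div_lt_iff₀ hpos] at hK
    nlinarith
  have h2 : k * |c| = |k * c| := by rw [abs_mul, Nat.abs_cast]
  have h3 : |k * c| ≤ 2 * M + 2 * H := by
    have h4 := hlin k
    have h5 := abs_le.mp (hB y)
    have h6 := abs_le.mp (hB (S^[k] y))
    have h7 := abs_le.mp hM
    have h8 := abs_le.mp hk'
    rw [abs_le]
    constructor <;> linarith
  linarith

/-- If a plane-valued function changes along an ergodic system by the vector `v` minus an integer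
vector that depends on a label, and `1`, `v 0`, `v 1` are rationally independent, then at least
two more words of length `n + 1` than of length `n` have positive measure. -/
theorem ncard_positiveWords_succ {Ω A : Type*} [MeasurableSpace Ω] {μ : Measure Ω}
    [IsFiniteMeasure μ] [NeZero μ] [Finite A] [MeasurableSpace A] [MeasurableSingletonClass A]
    {S : Ω → Ω} (hS : Ergodic S μ) {ℓ : Ω → A} (hℓ : AEMeasurable ℓ μ)
    {g : Ω → Plane} (hg : AEMeasurable g μ) {v : Plane}
    (hv : ∀ a b c : ℤ, (a : ℝ) + b * v 0 + c * v 1 = 0 → a = 0 ∧ b = 0 ∧ c = 0)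
    {N : A → Fin 2 → ℤ}
    (hstep : ∀ᵐ y ∂μ, g (S y) = g y + v - fun c => (N (ℓ y) c : ℝ)) (n : ℕ) :
    (positiveWords μ S ℓ n).ncard + 2 ≤ (positiveWords μ S ℓ (n + 1)).ncard := by
  classical
  have hq := hS.quasiErgodic.toQuasiMeasurePreserving
  set V := positiveWords μ S ℓ n with hV
  set E := positiveWords μ S ℓ (n + 1) with hE
  have : Fintype V := Fintype.ofFinite _
  have : Fintype E := Fintype.ofFinite _
  obtain ⟨y₀, hy₀⟩ := (ae_orbitWord_mem_positiveWords (μ := μ) (S := S) (ℓ := ℓ) n).exists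
  let u₀ : V := ⟨_, hy₀⟩
  -- Coboundary of a vertex function plus a combination of the three edge functions; the extra
  -- coordinate at `u₀` detects the constants, which the coboundary kills.
  let Φ : ((V → ℤ) × (Fin 3 → ℤ)) →ₗ[ℤ] ((E → ℤ) × ℤ) :=
    { toFun := fun p => (fun w => p.1 ⟨_, tail_mem_positiveWords hq w.2⟩
          - p.1 ⟨_, init_mem_positiveWords w.2⟩
          + (p.2 0 + p.2 1 * N (w.1 0) 0 + p.2 2 * N (w.1 0) 1), p.1 u₀)
      map_add' := fun p q => by
        ext <;> simp
        ring
      map_smul' := fun r p => by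
        ext <;> simp
        ring }
  have hinj : Function.Injective Φ := by
    rw [injective_iff_map_eq_zero]
    rintro ⟨h, a⟩ hp
    have hp1 : ∀ w : E, h ⟨_, tail_mem_positiveWords hq w.2⟩
          - h ⟨_, init_mem_positiveWords w.2⟩
          + (a 0 + a 1 * N (w.1 0) 0 + a 2 * N (w.1 0) 1) = 0 :=
      fun w => congrFun (congrArg Prod.fst hp) w
    have hp2 : h u₀ = 0 := congrArg Prod.snd hp
    let h' : (Fin n → A) → ℤ := fun u => if hu : u ∈ V then h ⟨u, hu⟩ else 0
    have hh' : ∀ u : V, h' u.1 = h u := fun u => by simp [h']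
    have hcoc : ∀ᵐ y ∂μ, h' (orbitWord S ℓ n (S y)) - h' (orbitWord S ℓ n y)
        + (a 0 + a 1 * N (ℓ y) 0 + a 2 * N (ℓ y) 1) = 0 := by
      filter_upwards [ae_orbitWord_mem_positiveWords (μ := μ) (S := S) (ℓ := ℓ) (n + 1)]
        with y hy
      have := hp1 ⟨_, hy⟩
      rw [← hh', ← hh'] at this
      exact this
    obtain ⟨H, hH⟩ : ∃ H : ℝ, ∀ u, |(h' u : ℝ)| ≤ H := by
      obtain ⟨H, hH⟩ := (Set.finite_range fun u => |(h' u : ℝ)|).bddAbove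
      exact ⟨H, fun u => hH ⟨u, rfl⟩⟩
    -- Adding `-(a 1 * g 0 + a 2 * g 1)` to the bounded `h'` cancels the integer vectors and leaves
    -- a constant increment.
    have hdrift : (a 0 : ℝ) + a 1 * v 0 + a 2 * v 1 = 0 := by
      have := drift_eq_zero hS.toMeasurePreserving
        (G := fun y => -((a 1 : ℝ) * g y 0 + a 2 * g y 1))
        (B := fun y => (h' (orbitWord S ℓ n y) : ℝ)) (H := H)
        (c := -((a 0 : ℝ) + a 1 * v 0 + a 2 * v 1))
        (by
          have := aemeasurable_pi_iff.mp hg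
          exact (((this 0).const_mul _).add ((this 1).const_mul _)).neg)
        (fun y => hH _)
        (by
          filter_upwards [hcoc, hstep] with y h1 h2
          have h3 : (h' (orbitWord S ℓ n (S y)) : ℝ) - h' (orbitWord S ℓ n y)
            + (a 0 + a 1 * N (ℓ y) 0 + a 2 * N (ℓ y) 1) = 0 := by exact_mod_cast h1
          rw [h2]
          simp only [Pi.sub_apply, Pi.add_apply]
          linarith)
      linarith
    obtain ⟨h0, h1, h2⟩ := hv _ _ _ hdrift
    have hinv : (fun y => h' (orbitWord S ℓ n y)) ∘ S =ᵐ[μ] fun y => h' (orbitWord S ℓ n y) := by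
      filter_upwards [hcoc] with y hy
      simp only [h0, h1, h2, zero_mul, add_zero] at hy
      exact sub_eq_zero.mp hy
    obtain ⟨c, hc⟩ := hS.ae_eq_const_of_ae_eq_comp₀
      ((measurable_of_finite h').comp_aemeasurable
        (aemeasurable_orbitWord hq hℓ n)).nullMeasurable hinv
    have hconst : ∀ u : V, h u = c := by
      intro u
      obtain ⟨y, hy, hy'⟩ := (Frequently.and_eventually u.2 hc).exists
      rw [← hh' u, ← hy]
      exact hy'
    have hc0 : c = 0 := by rw [← hconst u₀, hp2]
    ext i
    · simp [hconst, hc0]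
    · fin_cases i <;> simp [h0, h1, h2]
  -- Ranks: `|V| + 3 ≤ |E| + 1`.
  have hrank := LinearMap.finrank_le_finrank_of_injective hinj
  simp only [Module.finrank_prod, Module.finrank_fintype_fun_eq_card, Fintype.card_fin,
    Module.finrank_self] at hrank
  rw [← Nat.card_coe_set_eq, ← Nat.card_coe_set_eq, Nat.card_eq_fintype_card,
    Nat.card_eq_fintype_card]
  omega

theorem two_mul_add_one_le_ncard_positiveWords {Ω A : Type*} [MeasurableSpace Ω] {μ : Measure Ω}
    [IsFiniteMeasure μ] [NeZero μ] [Finite A] [MeasurableSpace A] [MeasurableSingletonClass A]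
    {S : Ω → Ω} (hS : Ergodic S μ) {ℓ : Ω → A} (hℓ : AEMeasurable ℓ μ)
    {g : Ω → Plane} (hg : AEMeasurable g μ) {v : Plane}
    (hv : ∀ a b c : ℤ, (a : ℝ) + b * v 0 + c * v 1 = 0 → a = 0 ∧ b = 0 ∧ c = 0)
    {N : A → Fin 2 → ℤ}
    (hstep : ∀ᵐ y ∂μ, g (S y) = g y + v - fun c => (N (ℓ y) c : ℝ)) (n : ℕ) :
    2 * n + 1 ≤ (positiveWords μ S ℓ n).ncard := by
  induction n with
  | zero =>
    obtain ⟨y, hy⟩ := (ae_orbitWord_mem_positiveWords (μ := μ) (S := S) (ℓ := ℓ) 0).exists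
    exact (Set.ncard_pos (Set.toFinite _)).mpr ⟨_, hy⟩
  | succ n ih =>
    have := ncard_positiveWords_succ hS hℓ hg hv hstep n
    omega

/-! ### Ergodicity, dense orbits and rational independence -/

theorem continuous_torusProj : Continuous torusProj :=
  continuous_pi fun i => (AddCircle.continuous_mk' 1).comp (continuous_apply i)

theorem denseRange_nsmul_torusProj {T : Plane → Plane} {v : Plane} (hT : ∀ x, T x = x + v)
    (hE : Ergodic (inducedMap T) (volume : Measure Torus)) :
    DenseRange fun n : ℕ => n • torusProj v := by
  have h : inducedMap T = fun p => torusProj v + p := by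
    funext p
    rw [inducedMap_of_translation hT, add_comm]
  rw [h] at hE
  -- By compactness of the torus, forward multiples are dense as soon as all multiples are.
  exact denseRange_zsmul_iff_nsmul.mp (DenseRange.zsmul_of_ergodic_add_left hE)

theorem eq_zero_of_forall_zsmul_coe_eq_zero {k : ℤ}
    (h : ∀ t : ℝ, k • (t : UnitAddCircle) = 0) : k = 0 := by
  by_contra hk
  have hk' : (k : ℝ) ≠ 0 := by exact_mod_cast hk
  -- This point is sent to `1/2`, which is not an integer.
  have := h (1 / (2 * k))
  rw [← AddCircle.coe_zsmul, AddCircle.coe_eq_zero_iff] at this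
  obtain ⟨n, hn⟩ := this
  simp only [zsmul_eq_mul, mul_one] at hn
  have h2 : (n : ℝ) * 2 = 1 := by
    rw [hn]
    field_simp
  have h3 : n * 2 = 1 := by exact_mod_cast h2
  omega

/-- The coordinates of a vector whose multiples are dense in the torus are rationally
independent of `1`. -/
theorem rationally_independent_of_denseRange {v : Plane}
    (hd : DenseRange fun n : ℕ => n • torusProj v) (a b c : ℤ)
    (h : (a : ℝ) + b * v 0 + c * v 1 = 0) : a = 0 ∧ b = 0 ∧ c = 0 := by
  have hv : b • (v 0 : UnitAddCircle) + c • (v 1 : UnitAddCircle) = 0 := by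
    rw [← AddCircle.coe_zsmul, ← AddCircle.coe_zsmul, ← AddCircle.coe_add,
      AddCircle.coe_eq_zero_iff]
    refine ⟨-a, ?_⟩
    simp only [zsmul_eq_mul, Int.cast_neg]
    linarith
  -- A rational relation gives a character that vanishes on a dense set, hence everywhere.
  have hχ : (fun p : Torus => b • p 0 + c • p 1) = fun _ => 0 := by
    refine hd.equalizer (by fun_prop) continuous_const ?_
    funext n
    simp only [Function.comp_apply, Pi.smul_apply]
    rw [smul_comm b, smul_comm c, ← smul_add]
    change n • (b • (v 0 : UnitAddCircle) + c • (v 1 : UnitAddCircle)) = 0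
    rw [hv, smul_zero]
  have hb : b = 0 := eq_zero_of_forall_zsmul_coe_eq_zero fun t => by
    simpa using congrFun hχ ![(t : UnitAddCircle), 0]
  have hc : c = 0 := eq_zero_of_forall_zsmul_coe_eq_zero fun t => by
    simpa using congrFun hχ ![0, (t : UnitAddCircle)]
  subst hb hc
  simpa using h

/-! ### Lower bound for an adapted exchange -/

theorem Transports.ae {X Y : Type*} [MeasurableSpace X] [MeasurableSpace Y] {f : X → Y}
    {μ : Measure X} {ν : Measure Y} (h : Transports f μ ν) {p : Y → Prop} (hp : ∀ᵐ y ∂ν, p y) :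
    ∀ᵐ x ∂μ, p (f x) :=
  ae_of_ae_map h.1 (by rwa [h.2])

theorem Transports.comp {X Y Z : Type*} [MeasurableSpace X] [MeasurableSpace Y]
    [MeasurableSpace Z] {f : X → Y} {g : Y → Z} {μ : Measure X} {ν : Measure Y} {ρ : Measure Z}
    (hg : Transports g ν ρ) (hf : Transports f μ ν) : Transports (g ∘ f) μ ρ := by
  have hg' : AEMeasurable g (μ.map f) := hf.2.symm ▸ hg.1
  refine ⟨hg'.comp_aemeasurable hf.1, ?_⟩
  rw [← AEMeasurable.map_map_of_aemeasurable hg' hf.1, hf.2, hg.2]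

theorem Transports.congr {X Y : Type*} [MeasurableSpace X] [MeasurableSpace Y] {f g : X → Y}
    {μ : Measure X} {ν : Measure Y} (h : Transports f μ ν) (hfg : f =ᵐ[μ] g) :
    Transports g μ ν :=
  ⟨h.1.congr hfg, by rw [← Measure.map_congr hfg, h.2]⟩

namespace PieceExchange

variable {R : PieceExchange} {T : Plane → Plane}

theorem coding_zero_iterate (x : Plane) (n : ℕ) : R.coding (R.map^[n] x) 0 = R.coding x n := rfl

theorem IsAdapted.nullMeasurableSet_domain (hA : R.IsAdapted T) :
    NullMeasurableSet R.domain volume :=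
  .iUnion hA.measurable_piece

theorem IsAdapted.ae_existsUnique_piece (hA : R.IsAdapted T) :
    ∀ᵐ x ∂(R.measure), ∃! i, x ∈ R.piece i := by
  have h1 : ∀ᵐ x ∂(R.measure), x ∈ R.domain := ae_restrict_mem₀ hA.nullMeasurableSet_domain
  have h2 : ∀ᵐ x ∂(R.measure), ∀ i j, i ≠ j → x ∉ R.piece i ∩ R.piece j := by
    refine ae_restrict_of_ae ?_
    simp only [ae_all_iff]
    exact fun i j hij => measure_eq_zero_iff_ae_notMem.mp (hA.disjoint i j hij)
  filter_upwards [h1, h2] with x hx hx'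
  obtain ⟨i, hi⟩ := Set.mem_iUnion.mp hx
  refine ⟨i, hi, fun j hj => ?_⟩
  by_contra hij
  exact hx' j i hij ⟨hj, hi⟩

theorem IsAdapted.ae_mem_codedPoints (hA : R.IsAdapted T) :
    ∀ᵐ x ∂(R.measure), x ∈ R.codedPoints := by
  refine ae_all_iff.mpr fun n => ?_
  induction n with
  | zero => exact hA.ae_existsUnique_piece
  | succ n ih => exact hA.conjugate.1.ae ih

theorem IsAdapted.aemeasurable_coding_zero (hA : R.IsAdapted T) :
    AEMeasurable (fun x => R.coding x 0) R.measure := by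
  refine NullMeasurable.aemeasurable fun s _ => ?_
  have h : NullMeasurableSet (⋃ i ∈ s, R.piece i) R.measure :=
    (NullMeasurableSet.biUnion s.to_countable fun i _ => hA.measurable_piece i).mono_ac
      Measure.restrict_le_self.absolutelyContinuous
  refine h.congr (eventuallyEq_set.mpr ?_)
  filter_upwards [hA.ae_mem_codedPoints] with x hx
  simp only [Set.mem_iUnion, Set.mem_preimage, exists_prop]
  constructor
  · rintro ⟨i, hi, hxi⟩
    rwa [(R.coding_eq_iff hx 0 i).mpr hxi]
  · exact fun hs => ⟨_, hs, (R.coding_eq_iff hx 0 _).mp rfl⟩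

theorem complexity_lower_bound (hA : R.IsAdapted T) {v : Plane} (hT : ∀ x, T x = x + v)
    (hE : Ergodic (inducedMap T) (volume : Measure Torus)) (n : ℕ) :
    2 * n + 1 ≤ R.complexity n := by
  obtain ⟨hR, hS, f, g, -, hg, hgf, hfg, hint⟩ := hA.conjugate
  obtain ⟨N, hN⟩ := hA.map_eq
  set S := inducedMap T
  have hgS : ∀ᵐ y ∂(volume : Measure Torus), g (S y) = R.map (g y) := by
    filter_upwards [hfg, hg.ae hint, hg.ae (hR.ae hgf)] with y h1 h2 h3
    rw [← h3, h2, h1]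
  have hgSn : ∀ᵐ y ∂(volume : Measure Torus), ∀ k, g (S^[k] y) = R.map^[k] (g y) := by
    refine ae_all_iff.mpr fun k => ?_
    induction k with
    | zero => simp
    | succ k ih =>
      filter_upwards [hS.ae ih, hgS] with y h1 h2
      rw [Function.iterate_succ_apply, h1, h2, Function.iterate_succ_apply]
  have hcoded := hg.ae hA.ae_mem_codedPoints
  let ℓ : Torus → Fin R.m := fun y => R.coding (g y) 0
  have hℓ : AEMeasurable ℓ (volume : Measure Torus) :=
    by
    refine AEMeasurable.comp_aemeasurable (g := fun x => R.coding x 0) ?_ hg.1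
    rw [hg.2]
    exact hA.aemeasurable_coding_zero
  have hstep : ∀ᵐ y ∂(volume : Measure Torus),
      g (S y) = g y + v - fun c => (N (ℓ y) c : ℝ) := by
    filter_upwards [hgS, hcoded] with y h1 h2
    obtain ⟨i, hi, hRi⟩ := hN (g y) (Set.mem_iUnion.mpr (h2 0).exists)
    have : ℓ y = i := (R.coding_eq_iff h2 0 i).mpr hi
    rw [h1, this, hRi, hT]
  refine (two_mul_add_one_le_ncard_positiveWords hE hℓ hg.1
    (rationally_independent_of_denseRange (denseRange_nsmul_torusProj hT hE)) hstep n).trans ?_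
  -- The language also contains words seen only on null sets, so an injection into it suffices.
  refine Set.ncard_le_ncard_of_injOn List.ofFn ?_ List.ofFn_injective.injOn
    ((List.finite_length_eq _ n).subset fun u hu => hu.2)
  intro u hu
  obtain ⟨y, hy, hy1, hy2⟩ := (Frequently.and_eventually hu (hgSn.and hcoded)).exists
  refine ⟨⟨_, ⟨g y, hy2, rfl⟩, 0, fun j hj => ?_⟩, List.length_ofFn⟩
  rw [List.getElem_ofFn, zero_add, ← coding_zero_iterate, ← hy1]
  exact (congrFun hy _).symm

end PieceExchange

/-! ### The exchange of four pieces of the unit square -/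

/-- The fundamental domain `[0,1)²`. -/
def unitBox : Set Plane := Set.univ.pi fun _ => Set.Ico 0 1

theorem measurable_torusProj : Measurable torusProj := continuous_torusProj.measurable

theorem measurable_torusRep : Measurable torusRep :=
  measurable_pi_lambda _ fun i => measurable_subtype_coe.comp
    ((AddCircle.measurableEquivIco (1 : ℝ) 0).measurable.comp (measurable_pi_apply i))

theorem torusRep_mem_unitBox (p : Torus) : torusRep p ∈ unitBox := fun i _ => by
  have h := (AddCircle.equivIco (1 : ℝ) 0 (p i)).2
  exact ⟨h.1, h.2.trans_eq (zero_add 1)⟩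

theorem torusRep_torusProj (x : Plane) : torusRep (torusProj x) = fun c => Int.fract (x c) := by
  funext c
  refine (AddCircle.coe_equivIco_mk_apply (1 : ℝ) (x c)).trans ?_
  rw [mul_one, div_one]

theorem torusRep_torusProj_of_mem {x : Plane} (hx : x ∈ unitBox) :
    torusRep (torusProj x) = x := by
  rw [torusRep_torusProj]
  funext c
  exact Int.fract_eq_self.mpr (hx c trivial)

theorem measurableSet_unitBox : MeasurableSet unitBox :=
  MeasurableSet.univ_pi fun _ => measurableSet_Ico

theorem transports_torusProj :
    Transports torusProj (volume.restrict unitBox) (volume : Measure Torus) := by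
  refine ⟨measurable_torusProj.aemeasurable, ?_⟩
  have h : (volume : Measure Plane).restrict unitBox
      = Measure.pi fun _ : Fin 2 => (volume : Measure ℝ).restrict (Set.Ioc 0 (0 + 1)) := by
    rw [zero_add, ← Measure.restrict_congr_set (Ico_ae_eq_Ioc (a := (0 : ℝ)) (b := 1))]
    exact Measure.restrict_pi_pi _ _
  rw [h]
  exact (measurePreserving_pi _ _ fun _ : Fin 2 => AddCircle.measurePreserving_mk 1 0).map_eq

theorem ae_torusRep_torusProj :
    ∀ᵐ x ∂(volume : Measure Plane).restrict unitBox, torusRep (torusProj x) = x := by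
  filter_upwards [ae_restrict_mem measurableSet_unitBox] with x hx
  exact torusRep_torusProj_of_mem hx

theorem transports_torusRep :
    Transports torusRep (volume : Measure Torus) (volume.restrict unitBox) := by
  refine ⟨measurable_torusRep.aemeasurable, ?_⟩
  rw [← transports_torusProj.2, Measure.map_map measurable_torusRep measurable_torusProj]
  exact (Measure.map_congr ae_torusRep_torusProj).trans Measure.map_id

/-- The integer vectors subtracted by the exchange of the four pieces of `[0,1)²`. -/
def carry (v : Plane) (i : Fin (2 ^ 2)) (c : Fin 2) : ℤ :=
  ⌊v c⌋ + (finFunctionFinEquiv.symm i c : ℕ)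

theorem carry_injective (v : Plane) : Function.Injective (carry v) := by
  intro i j h
  apply finFunctionFinEquiv.symm.injective
  funext c
  have := congrFun h c
  simp only [carry, add_right_inj, Nat.cast_inj] at this
  exact Fin.ext this

theorem exists_carry_eq {x : Plane} (hx : x ∈ unitBox) (v : Plane) :
    ∃ i, ∀ c, ⌊x c + v c⌋ = carry v i c := by
  -- Since `0 ≤ x c < 1`, the carry is 0 or 1.
  have h : ∀ c, ∃ d : Fin 2, ⌊x c + v c⌋ = ⌊v c⌋ + (d : ℕ) := by
    intro c
    obtain ⟨h0, h1⟩ := hx c trivial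
    rcases lt_or_ge (x c + v c) (⌊v c⌋ + 1) with hlt | hge
    · refine ⟨0, ?_⟩
      rw [Int.floor_eq_iff]
      push_cast
      constructor <;> simp <;> linarith [Int.floor_le (v c)]
    · refine ⟨1, ?_⟩
      rw [Int.floor_eq_iff]
      push_cast
      constructor <;> simp <;> linarith [Int.lt_floor_add_one (v c)]
  choose d hd using h
  exact ⟨finFunctionFinEquiv d, fun c => by simp [carry, hd c]⟩

/-- The exchange of the four pieces of `[0,1)²` induced by the translation of vector `v`. -/
def boxExchange (v : Plane) : PieceExchange where
  m := 2 ^ 2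
  m_pos := by norm_num
  piece i := {x | x ∈ unitBox ∧ ∀ c, ⌊x c + v c⌋ = carry v i c}
  map x := torusRep (torusProj (x + v))

namespace boxExchange

variable {v : Plane} {T : Plane → Plane}

theorem existsUnique_piece {x : Plane} (hx : x ∈ unitBox) :
    ∃! i, x ∈ (boxExchange v).piece i := by
  obtain ⟨i, hi⟩ := exists_carry_eq hx v
  exact ⟨i, ⟨hx, hi⟩, fun j hj => carry_injective v (funext fun c => by rw [← hi c, hj.2 c])⟩

theorem domain_eq (v : Plane) : (boxExchange v).domain = unitBox :=
  Set.Subset.antisymm (Set.iUnion_subset fun _ _ hx => hx.1)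
    fun _ hx => Set.mem_iUnion.mpr (existsUnique_piece hx).exists

theorem measure_eq (v : Plane) : (boxExchange v).measure = volume.restrict unitBox := by
  rw [PieceExchange.measure, domain_eq]

theorem measurableSet_piece (i : Fin (boxExchange v).m) : MeasurableSet ((boxExchange v).piece i) := by
  refine measurableSet_unitBox.inter (MeasurableSet.congr
    (s := ⋂ c, (fun x : Plane => ⌊x c + v c⌋) ⁻¹' {carry v i c}) ?_ (by ext x; exact Set.mem_iInter))
  refine .iInter fun c => ?_
  have : Measurable fun x : Plane => ⌊x c + v c⌋ :=
    ((measurable_pi_apply c).add_const _).floor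
  exact this (measurableSet_singleton _)

theorem map_torusRep (hT : ∀ x, T x = x + v) (p : Torus) :
    (boxExchange v).map (torusRep p) = torusRep (inducedMap T p) := by
  simp [boxExchange, inducedMap, hT]

theorem iterate_map_torusRep (hT : ∀ x, T x = x + v) (p : Torus) (n : ℕ) :
    (boxExchange v).map^[n] (torusRep p) = torusRep ((inducedMap T)^[n] p) := by
  have h : Function.Semiconj torusRep (inducedMap T) (boxExchange v).map :=
    fun p => (map_torusRep hT p).symm
  exact (h.iterate_right n p).symm

/-- The pieces partition the box exactly and the map preserves it, so no null set has to be
discarded. -/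
theorem torusRep_mem_codedPoints (hT : ∀ x, T x = x + v) (p : Torus) :
    torusRep p ∈ (boxExchange v).codedPoints := fun n => by
  rw [iterate_map_torusRep hT]
  exact existsUnique_piece (torusRep_mem_unitBox _)

theorem map_eq {x : Plane} {i : Fin (boxExchange v).m} (hx : x ∈ (boxExchange v).piece i) :
    (boxExchange v).map x = x + v - fun c => (carry v i c : ℝ) := by
  change torusRep (torusProj (x + v)) = _
  rw [torusRep_torusProj]
  funext c
  simp only [Pi.sub_apply, Pi.add_apply, ← hx.2 c]
  rfl

theorem isAdapted (hT : ∀ x, T x = x + v)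
    (hS : Transports (inducedMap T) (volume : Measure Torus) volume) :
    (boxExchange v).IsAdapted T where
  conjugate := by
    rw [measure_eq]
    refine ⟨?_, hS, torusProj, torusRep, transports_torusProj, transports_torusRep,
      ae_torusRep_torusProj, ae_of_all _ torusProj_torusRep, ?_⟩
    · refine ((transports_torusRep.comp hS).comp transports_torusProj).congr ?_
      filter_upwards [ae_torusRep_torusProj] with x hx
      simp only [Function.comp_apply]
      rw [← map_torusRep hT, hx]
    · filter_upwards [ae_torusRep_torusProj] with x hx
      rw [← torusProj_torusRep (inducedMap T (torusProj x)), ← map_torusRep hT, hx]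
  measurable_piece i := (measurableSet_piece i).nullMeasurableSet
  disjoint i j hij := by
    have : (boxExchange v).piece i ∩ (boxExchange v).piece j = ∅ :=
      Set.eq_empty_of_forall_notMem fun x hx =>
        hij ((existsUnique_piece hx.1.1).unique hx.1 hx.2)
    rw [this, measure_empty]
  injective_mod := by
    convert measure_empty (μ := (volume : Measure Plane))
    refine Set.eq_empty_of_forall_notMem ?_
    rintro x ⟨hx, y, hy, hne, k, hk⟩
    rw [domain_eq] at hx hy
    refine hne ?_
    have h : torusProj x = torusProj y := by
      funext c
      have hc : x c - y c = k c := congrFun hk c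
      refine sub_eq_zero.mp ?_
      change ((x c : ℝ) : UnitAddCircle) - ((y c : ℝ) : UnitAddCircle) = 0
      rw [← AddCircle.coe_sub, AddCircle.coe_eq_zero_iff]
      exact ⟨k c, by simp [hc]⟩
    rw [← torusRep_torusProj_of_mem hx, ← torusRep_torusProj_of_mem hy, h]
  map_eq := ⟨carry v, fun x hx => by
    rw [domain_eq] at hx
    obtain ⟨i, hi, -⟩ := existsUnique_piece (v := v) hx
    exact ⟨i, hi, by rw [map_eq hi, hT]⟩⟩

/-! ### Injectivity of the coding and conjugacy -/

/-- The coding of the points of the torus. -/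
def torusCoding (v : Plane) (p : Torus) : ℕ → Fin (boxExchange v).m :=
  (boxExchange v).coding (torusRep p)

theorem torusCoding_eq_iff (hT : ∀ x, T x = x + v) (p : Torus) (n : ℕ) (i : Fin (boxExchange v).m) :
    torusCoding v p n = i ↔ torusRep ((inducedMap T)^[n] p) ∈ (boxExchange v).piece i := by
  rw [← iterate_map_torusRep hT]
  exact (boxExchange v).coding_eq_iff (torusRep_mem_codedPoints hT p) n i

theorem continuous_inducedMap (hT : ∀ x, T x = x + v) : Continuous (inducedMap T) := by
  rw [funext (inducedMap_of_translation hT)]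
  fun_prop

theorem measurable_torusCoding (hT : ∀ x, T x = x + v) : Measurable (torusCoding v) := by
  refine measurable_pi_lambda _ fun n => measurable_to_countable' fun i => ?_
  have : (fun p => torusCoding v p n) ⁻¹' {i}
      = (fun p => torusRep ((inducedMap T)^[n] p)) ⁻¹' (boxExchange v).piece i := by
    ext p
    exact torusCoding_eq_iff hT p n i
  rw [this]
  exact (measurable_torusRep.comp ((continuous_inducedMap hT).iterate n).measurable)
    (measurableSet_piece i)

theorem torusCoding_inducedMap (hT : ∀ x, T x = x + v) (p : Torus) :
    torusCoding v (inducedMap T p) = shiftMap (torusCoding v p) := by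
  funext n
  rw [torusCoding_eq_iff hT, ← Function.iterate_succ_apply, ← torusCoding_eq_iff hT]
  rfl

/-- Equal letters subtract equal integer vectors at every step. -/
theorem torusRep_iterate_sub (hT : ∀ x, T x = x + v) {p q : Torus}
    (h : torusCoding v p = torusCoding v q) (n : ℕ) :
    torusRep ((inducedMap T)^[n] p) - torusRep ((inducedMap T)^[n] q)
      = torusRep p - torusRep q := by
  induction n with
  | zero => rfl
  | succ n ih =>
    have hp := (torusCoding_eq_iff hT p n _).mp rfl
    have hq := (torusCoding_eq_iff hT q n _).mp rfl
    rw [Function.iterate_succ_apply', Function.iterate_succ_apply', ← map_torusRep hT,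
      ← map_torusRep hT, map_eq hp, map_eq hq, h, ← ih]
    abel

theorem iterate_inducedMap (hT : ∀ x, T x = x + v) (p : Torus) (n : ℕ) :
    (inducedMap T)^[n] p = p + n • torusProj v := by
  rw [funext (inducedMap_of_translation hT), add_right_iterate]

/-- If a coordinate of `p` exceeded that of `q`, density would bring it along the orbit below the
constant gap, making the coordinate of `q` negative. -/
theorem torusRep_le_of_torusCoding_eq (hT : ∀ x, T x = x + v)
    (hd : DenseRange fun n : ℕ => n • torusProj v) {p q : Torus}
    (h : torusCoding v p = torusCoding v q) : torusRep p ≤ torusRep q := by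
  intro c
  by_contra! hlt
  have hq0 : 0 ≤ torusRep q c := (torusRep_mem_unitBox q c trivial).1
  have hp1 : torusRep p c < 1 := (torusRep_mem_unitBox p c trivial).2
  let U : Set Torus := (fun r => (p + r) c) ⁻¹'
    ((QuotientAddGroup.mk : ℝ → UnitAddCircle) '' Set.Ioo 0 (torusRep p c - torusRep q c))
  have hU : IsOpen U := (QuotientAddGroup.isOpenMap_coe _ isOpen_Ioo).preimage (by fun_prop)
  have hne : U.Nonempty := by
    refine ⟨torusProj (fun _ => (torusRep p c - torusRep q c) / 2) - p,
      (torusRep p c - torusRep q c) / 2, ⟨by linarith, by linarith⟩, ?_⟩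
    simp [torusProj]
  obtain ⟨n, t, ht, htn⟩ := hd.exists_mem_open hU hne
  have h1 : torusRep ((inducedMap T)^[n] p) c = t := by
    have h2 : (AddCircle.equivIco (1 : ℝ) 0 (t : UnitAddCircle) : ℝ) = t :=
      AddCircle.equivIco_coe_of_mem ⟨ht.1.le, by linarith [ht.2]⟩
    rw [iterate_inducedMap hT]
    change (AddCircle.equivIco (1 : ℝ) 0 ((p + n • torusProj v) c) : ℝ) = t
    rw [← h2]
    exact congrArg (fun r => (AddCircle.equivIco (1 : ℝ) 0 r : ℝ)) htn.symm
  have h3 := congrFun (torusRep_iterate_sub hT h n) c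
  simp only [Pi.sub_apply, h1] at h3
  have h4 : 0 ≤ torusRep ((inducedMap T)^[n] q) c := (torusRep_mem_unitBox _ c trivial).1
  linarith [ht.2]

theorem torusCoding_injective (hT : ∀ x, T x = x + v)
    (hd : DenseRange fun n : ℕ => n • torusProj v) : Function.Injective (torusCoding v) := by
  intro p q h
  rw [← torusProj_torusRep p, ← torusProj_torusRep q]
  exact congrArg _ (le_antisymm (torusRep_le_of_torusCoding_eq hT hd h)
    (torusRep_le_of_torusCoding_eq hT hd h.symm))

theorem symbolicMeasure_eq (hT : ∀ x, T x = x + v) :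
    (boxExchange v).symbolicMeasure = (volume : Measure Torus).map (torusCoding v) := by
  have h : (boxExchange v).coding =ᵐ[volume.restrict unitBox] torusCoding v ∘ torusProj := by
    filter_upwards [ae_torusRep_torusProj] with x hx
    simp [torusCoding, hx]
  rw [PieceExchange.symbolicMeasure, measure_eq, Measure.map_congr h,
    ← Measure.map_map (measurable_torusCoding hT) measurable_torusProj, transports_torusProj.2]

theorem isConjugateTo (hT : ∀ x, T x = x + v)
    (hE : Ergodic (inducedMap T) (volume : Measure Torus)) :
    (boxExchange v).IsConjugateTo T := by
  have hS : Transports (inducedMap T) (volume : Measure Torus) volume :=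
    ⟨hE.measurable.aemeasurable, hE.toMeasurePreserving.map_eq⟩
  refine ⟨isAdapted hT hS, ?_⟩
  have hm := measurable_torusCoding hT
  -- Lusin–Souslin: an injective Borel map between standard Borel spaces has a Borel inverse on its
  -- image.
  have hemb : MeasurableEmbedding (torusCoding v) :=
    hm.measurableEmbedding (torusCoding_injective hT (denseRange_nsmul_torusProj hT hE))
  have hσ := symbolicMeasure_eq hT
  have hg : Transports (torusCoding v) volume (boxExchange v).symbolicMeasure :=
    ⟨hm.aemeasurable, hσ.symm⟩
  have hinv : ∀ p, hemb.invFun (torusCoding v p) = p := hemb.leftInverse_invFun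
  have hshift : Measurable (shiftMap : (ℕ → Fin (boxExchange v).m) → _) :=
    measurable_pi_lambda _ fun n => measurable_pi_apply (n + 1)
  have hf : Transports hemb.invFun (boxExchange v).symbolicMeasure volume := by
    refine ⟨hemb.measurable_invFun.aemeasurable, ?_⟩
    rw [hσ, Measure.map_map hemb.measurable_invFun hm]
    exact (congrArg (Measure.map · volume) (funext hinv)).trans Measure.map_id
  have hae : ∀ {P : (ℕ → Fin (boxExchange v).m) → Prop}, (∀ p, P (torusCoding v p)) →
      ∀ᵐ w ∂(boxExchange v).symbolicMeasure, P w := by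
    intro P hP
    rw [hσ, hemb.ae_map_iff]
    exact ae_of_all _ hP
  refine ⟨⟨hshift.aemeasurable, ?_⟩, hS, hemb.invFun, torusCoding v, hf, hg,
    hae fun p => by rw [hinv], ae_of_all _ hinv,
    hae fun p => by rw [← torusCoding_inducedMap hT, hinv, hinv]⟩
  rw [hσ]
  refine (Measure.map_map hshift hm).trans ?_
  refine (congrArg (Measure.map · volume) (funext (torusCoding_inducedMap hT)).symm).trans ?_
  exact (Measure.map_map hm hE.measurable).symm.trans (by rw [hS.2])

end boxExchange

theorem mainTheorem1 (T : Plane → Plane) (v : Plane) (hT : ∀ x, T x = x + v)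
    (hE : Ergodic (inducedMap T) (volume : Measure Torus)) :
    (∃ R : PieceExchange, R.IsConjugateTo T) ∧
      ∀ n : ℕ, 2 * n + 1 ≤ mapComplexity T n := by
  have hR := boxExchange.isConjugateTo hT hE
  refine ⟨⟨_, hR⟩, fun n => ?_⟩
  -- Existence matters here: `sInf ∅ = 0` in `ℕ`, while a nonempty set attains its infimum.
  obtain ⟨R, hR', hk⟩ : mapComplexity T n ∈ {k : ℕ | ∃ R : PieceExchange,
      R.IsConjugateTo T ∧ k = R.complexity n} := Nat.sInf_mem ⟨_, _, hR, rfl⟩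
  rw [hk]
  exact R.complexity_lower_bound hR'.1 hT hE n

end
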